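/- Consider $n$ bosonic modes of one frequency $\omega>0$, with quadratures $\hat x_i,\hat p_i$, $[\hat x_i,\hat p_j]=i\delta_{ij}$, and ladder operators $\hat a_i=(\hat x_i+i\hat p_i)/\sqrt2$, and a background inverse temperature $\beta>0$. A zero-mean Gaussian state is described by its covariance matrix, i.e. a real symmetric matrix $\sigma$ with $\sigma+\frac i2\Omega\ge 0$, where $\Omega$ is the symplectic form; the thermal state has covariance matrix $\nu\mathbb 1$ with $\nu=\frac12\,\frac{e^{\beta\omega}+1}{e^{\beta\omega}-1}$. Let $M_{ij}=\langle \hat a_j^\dagger \hat a_i\rangle-(\nu-\frac12)\delta_{ij}$ be the matrix of second moments shifted so that $M=0$ for the thermal state. A Gaussian thermal operation with $b$ bath modes adjoins $b$ modes in the thermal state, applies a joint passive linear unitary $S\in \mathrm{Sp}\cap\mathrm{O}$, $\sigma\mapsto S\sigma S^T$, and traces out the bath; it is bath-free if $b=0$. A weak catalytic transformation from $M$ to $M'$ with $c$ catalyst modes takes a system state with matrix $M$, in product with a state of $c$ catalyst modes with matrix $M_{\mathrm C}$, by a Gaussian thermal operation to a joint (possibly correlated) state whose matrix has system block $M'$ and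 catalyst block $M_{\mathrm C}$. Let $M$ be the matrix of an arbitrary $n$-mode state, let $M'$ be a Hermitian $n\times n$ matrix, and let $\mu,\mu'\in\mathbb R^n$ be their eigenvalues (with multiplicity) in non-increasing order. Let $\mu^+\in\mathbb R^n$ (resp. $\mu^-\in\mathbb R^n$) be the non-increasing list of the positive entries of $\mu$ (resp. of the absolute values of its negative entries), padded with zeros, and likewise for $\mu'$. For non-increasing $x,y\in\mathbb R^n$ write $x\prec_w y$ if $\sum_{i\le k}x_i\le\sum_{i\le k}y_i$ for $k=1,\dots,n$, and $x\prec y$ if moreover $\sum_{i=1}^n x_i=\sum_{i=1}^n y_i$. Then, for every system state with matrix $M$: 1. A weak catalytic transformation of this state from $M$ to $M'$ is possible without a thermal bath (with some number of catalyst modes) if and only if $\mu'\prec\mu$. If it is possible, then it is possible with at most $n-1$ catalyst modes. 2. A weak catalytic transformation of this state from $M$ to $M'$ is possible with the use of a thermal bath (with some numbers of catalyst and bath modes) if and only if $\mu'^+\prec_w\mu^+$ and $\mu'^-\prec_w\mu^-$. If it is possible, then it is possible with at most $n-1$ catalyst modes and at most $n$ bath modes. (For $n=0$, read $n-1$ as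 $0$.) -/

import Mathlib

/-!
Bosonic modes labelled by a type `ι`, all of one frequency `ω`; the quadratures are labelled by
`ι ⊕ ι`, where `inl i` stands for `x_i` and `inr i` for `p_i`, and `[x_i, p_j] = i δ_ij`.
A zero-mean Gaussian state is given by its covariance matrix.
-/

namespace GaussianThermal

/-- The symplectic form `Ω = [[0, 1], [-1, 0]]` of the commutation relations
`[r_i, r_j] = i Ω_ij`, in the ordering `(x, p)`. -/
def symplecticForm (ι : Type*) [DecidableEq ι] : Matrix (ι ⊕ ι) (ι ⊕ ι) ℝ :=
  Matrix.fromBlocks 0 1 (-1) 0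

open scoped ComplexOrder in
/-- `σ` is the covariance matrix of a quantum state: it is real symmetric and satisfies the
uncertainty principle `σ + (i/2) Ω ≥ 0`. -/
def IsCovarianceMatrix {ι : Type*} [DecidableEq ι]
    (σ : Matrix (ι ⊕ ι) (ι ⊕ ι) ℝ) : Prop :=
  σ.IsSymm ∧
    (σ.map Complex.ofReal +
      (Complex.I / 2) • (symplecticForm ι).map Complex.ofReal).PosSemidef

/-- The variance of each quadrature of a mode of frequency `ω` in the thermal state at inverse
temperature `β`, that is `(1/2) coth (βω/2)`. -/
noncomputable def thermalVariance (β ω : ℝ) : ℝ :=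
  (Real.exp (β * ω) + 1) / (2 * (Real.exp (β * ω) - 1))

/-- The covariance matrix of the thermal state of modes of frequency `ω` at inverse
temperature `β`. -/
noncomputable def thermalCovariance (β ω : ℝ) (ι : Type*) [DecidableEq ι] :
    Matrix (ι ⊕ ι) (ι ⊕ ι) ℝ :=
  thermalVariance β ω • (1 : Matrix (ι ⊕ ι) (ι ⊕ ι) ℝ)

/-- Passive linear unitaries `K = Sp ∩ O`, acting on covariance matrices by `σ ↦ S σ Sᵀ`. -/
def passive (ι : Type*) [Fintype ι] [DecidableEq ι] :
    Submonoid (Matrix (ι ⊕ ι) (ι ⊕ ι) ℝ) :=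
  Matrix.symplecticGroup ι ℝ ⊓ Matrix.orthogonalGroup (ι ⊕ ι) ℝ

/-- The covariance matrix `σ ⊕ τ` of the product of two states. -/
def product {ι κ : Type*} (σ : Matrix (ι ⊕ ι) (ι ⊕ ι) ℝ) (τ : Matrix (κ ⊕ κ) (κ ⊕ κ) ℝ) :
    Matrix ((ι ⊕ κ) ⊕ (ι ⊕ κ)) ((ι ⊕ κ) ⊕ (ι ⊕ κ)) ℝ :=
  (Matrix.fromBlocks σ 0 0 τ).submatrix
    (Equiv.sumSumSumComm ι κ ι κ) (Equiv.sumSumSumComm ι κ ι κ)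

/-- The covariance matrix of the reduced state on the modes `f k`; all other modes are
traced out. -/
def reduced {ι κ : Type*} (f : κ → ι) (σ : Matrix (ι ⊕ ι) (ι ⊕ ι) ℝ) :
    Matrix (κ ⊕ κ) (κ ⊕ κ) ℝ :=
  σ.submatrix (Sum.map f f) (Sum.map f f)

/-- `σ` is mapped to `τ` by a Gaussian thermal operation with `b` bath modes: adjoin `b` modes in
the thermal state, apply a joint passive linear unitary, trace out the bath. For `b = 0` this is
a passive linear unitary without use of a bath. -/
def GTO (β ω : ℝ) (b : ℕ) {ι : Type*} [Fintype ι] [DecidableEq ι]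
    (σ τ : Matrix (ι ⊕ ι) (ι ⊕ ι) ℝ) : Prop :=
  ∃ S ∈ passive (ι ⊕ Fin b),
    τ = reduced Sum.inl (S * product σ (thermalCovariance β ω (Fin b)) * S.transpose)

/-- The matrix `M` of a zero-mean state. With `a = (x + i p)/√2` and thermal occupation number
`N` it is `M_ij = ⟨a_j† a_i⟩ - N δ_ij`. In terms of the covariance matrix,
`Re M_ij = (⟨x_i x_j⟩ + ⟨p_i p_j⟩)/2 - ν δ_ij` and `Im M_ij = (⟨x_j p_i⟩ - ⟨x_i p_j⟩)/2`,
where `ν = N + 1/2` is the thermal variance and products are symmetrised. -/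
noncomputable def modeMatrix (β ω : ℝ) {ι : Type*} [DecidableEq ι]
    (σ : Matrix (ι ⊕ ι) (ι ⊕ ι) ℝ) : Matrix ι ι ℂ :=
  Matrix.of fun i j =>
    (((σ (.inl i) (.inl j) + σ (.inr i) (.inr j)) / 2 : ℝ) : ℂ)
      + (((σ (.inl j) (.inr i) - σ (.inl i) (.inr j)) / 2 : ℝ) : ℂ) * Complex.I
      - if i = j then (thermalVariance β ω : ℂ) else 0

/-- The modes of the system in state `σ` can be transformed, at the level of the `M` matrix, into
`M'` by a weak catalytic Gaussian thermal operation with `c` catalyst modes and `b` bath modes: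
there is a catalyst state `σC`, initially uncorrelated with the system, such that `σ ⊕ σC` is
mapped to a joint state `τ` whose `M` matrix has system block `M'` and has the same catalyst
block as before. The final system-catalyst correlations are arbitrary. -/
def WeakCatalytic (β ω : ℝ) (c b : ℕ) {n : ℕ}
    (σ : Matrix (Fin n ⊕ Fin n) (Fin n ⊕ Fin n) ℝ) (M' : Matrix (Fin n) (Fin n) ℂ) : Prop :=
  ∃ σC : Matrix (Fin c ⊕ Fin c) (Fin c ⊕ Fin c) ℝ, IsCovarianceMatrix σC ∧
    ∃ τ : Matrix ((Fin n ⊕ Fin c) ⊕ (Fin n ⊕ Fin c)) ((Fin n ⊕ Fin c) ⊕ (Fin n ⊕ Fin c)) ℝ,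
      GTO β ω b (product σ σC) τ ∧
      modeMatrix β ω (reduced Sum.inl τ) = M' ∧
      modeMatrix β ω (reduced Sum.inr τ) = modeMatrix β ω σC

/-- The eigenvalues of a Hermitian matrix with multiplicity, in non-increasing order. -/
noncomputable def eigenvalueVector {n : ℕ} {M : Matrix (Fin n) (Fin n) ℂ}
    (hM : M.IsHermitian) : Fin n → ℝ :=
  fun i => hM.eigenvalues₀ (Fin.cast (Fintype.card_fin n).symm i)

/-- For non-increasing `μ`, the non-increasing list of its positive entries, padded with zeros. -/
def superThermal {n : ℕ} (μ : Fin n → ℝ) : Fin n → ℝ := fun i => max (μ i) 0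

/-- For non-increasing `μ`, the non-increasing list of the absolute values of its negative
entries, padded with zeros. -/
def subThermal {n : ℕ} (μ : Fin n → ℝ) : Fin n → ℝ := fun i => max (-μ (Fin.rev i)) 0

/-- Weak majorisation `x ≺_w y` of non-increasing vectors: the sum of the first `k` entries of
`x` is at most that of `y`, for `k = 1, …, n`. -/
def WeaklyMajorised {n : ℕ} (x y : Fin n → ℝ) : Prop :=
  ∀ k : Fin n, ∑ i ∈ Finset.Iic k, x i ≤ ∑ i ∈ Finset.Iic k, y i

/-- Majorisation `x ≺ y` of non-increasing vectors. -/
def Majorised {n : ℕ} (x y : Fin n → ℝ) : Prop :=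
  WeaklyMajorised x y ∧ ∑ i, x i = ∑ i, y i

end GaussianThermal

namespace GaussianThermal

open Matrix

/-! On ladder operators a passive symplectic map is a unitary `U`, and the mode matrix transforms by
`U M Uᴴ`. A thermal bath is a zero block, so everything reduces to unitary conjugation of `M ⊕ MC ⊕
0` with prescribed diagonal blocks.

Necessity (`WeakCatalytic.sum_convex_le`): in bases diagonalising the system and catalyst blocks,
the diagonal entries after conjugation are bistochastic averages of the eigenvalues before it.
Jensen's inequality compares the sums of any convex `φ`, and the catalyst terms, equal on both
sides, cancel. Without a bath, the functions `max (x - t) 0` and `±x` give majorisation. With a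
bath, `φ ≥ 0` and `φ 0 = 0` make the bath terms harmless; `max (±x - t) 0` with `t ≥ 0` gives the
two weak majorisations.

Sufficiency (`exists_pairwise_averaging`, `exists_catalyst_spectrum`): if `v` majorises `u`, the
entries of `u` can be produced one at a time by mixing two neighbouring entries of the current list,
leaving a by-product that re-enters the list. A catalyst whose spectrum consists of the `n - 1`
by-products supplies them in advance and receives them back, so all the mixings happen at once, in a
single unitary. With a bath (`exists_attenuation`), mixing each eigenmode with one bath mode first
shrinks `μ i` to `q i * μ i`, with `q` chosen so that the shrunk spectrum majorises the target. -/

/-- The complex diagonal matrix with given real entries. -/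
noncomputable def realDiagonal {ι : Type*} [DecidableEq ι] (a : ι → ℝ) : Matrix ι ι ℂ := diagonal fun i => (a i : ℂ)

theorem fromBlocks_realDiagonal {ι κ : Type*} [DecidableEq ι] [DecidableEq κ] (a : ι → ℝ) (b : κ → ℝ) :
    fromBlocks (realDiagonal a) 0 0 (realDiagonal b) = realDiagonal (Sum.elim a b) := by
  rw [realDiagonal, realDiagonal, fromBlocks_diagonal, realDiagonal]
  congr 1
  ext (i | i) <;> rfl

theorem exists_equiv_of_multiset_eq {ι κ : Type*} [Fintype ι] [Fintype κ] {α : Type*} [DecidableEq α] {g : ι → α} {h : κ → α}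
    (H : ∑ i, ({g i} : Multiset α) = ∑ j, {h j}) : ∃ e : ι ≃ κ, ∀ i, g i = h (e i) := by
  have card (x : α) : Fintype.card {i // g i = x} = Fintype.card {j // h j = x} := by
    have := congrArg (Multiset.count x) H
    simp only [Multiset.count_sum', Multiset.count_singleton, Finset.sum_boole] at this
    rw [Fintype.card_subtype, Fintype.card_subtype]
    simpa [eq_comm] using this
  let e := (Equiv.sigmaFiberEquiv g).symm.trans
    ((Equiv.sigmaCongrRight fun x => Fintype.equivOfCardEq (card x)).trans
      (Equiv.sigmaFiberEquiv h))
  refine ⟨e, fun i => ?_⟩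
  exact (Fintype.equivOfCardEq (card (g i)) ⟨i, rfl⟩).2.symm

/-! ### Unitary equivalence, mode mixing and Jensen's inequality -/

section UnitaryEquivalence

variable {ι κ ι' κ' : Type*} [Fintype ι] [Fintype κ] [Fintype ι'] [Fintype κ']
  [DecidableEq ι] [DecidableEq κ] [DecidableEq ι'] [DecidableEq κ']

/-- Unitary equivalence of complex matrices, possibly with different index types. -/
def UEquiv (A : Matrix κ κ ℂ) (B : Matrix ι ι ℂ) : Prop :=
  ∃ U : Matrix ι κ ℂ, U * Uᴴ = 1 ∧ Uᴴ * U = 1 ∧ B = U * A * Uᴴ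

theorem UEquiv.refl (A : Matrix ι ι ℂ) : UEquiv A A :=
  ⟨1, by simp, by simp, by simp⟩

theorem UEquiv.symm {A : Matrix κ κ ℂ} {B : Matrix ι ι ℂ} (h : UEquiv A B) : UEquiv B A := by
  obtain ⟨U, h1, h2, rfl⟩ := h
  refine ⟨Uᴴ, by simpa using h2, by simpa using h1, ?_⟩
  rw [conjTranspose_conjTranspose, ← Matrix.mul_assoc, ← Matrix.mul_assoc, h2, Matrix.one_mul,
    Matrix.mul_assoc, h2, Matrix.mul_one]

theorem UEquiv.trans {A : Matrix κ κ ℂ} {B : Matrix ι ι ℂ} {C : Matrix ι' ι' ℂ}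
    (h : UEquiv A B) (h' : UEquiv B C) : UEquiv A C := by
  obtain ⟨U, h1, h2, rfl⟩ := h
  obtain ⟨V, g1, g2, rfl⟩ := h'
  refine ⟨V * U, ?_, ?_, ?_⟩
  · rw [conjTranspose_mul, Matrix.mul_assoc, ← Matrix.mul_assoc U, h1, Matrix.one_mul, g1]
  · rw [conjTranspose_mul, Matrix.mul_assoc, ← Matrix.mul_assoc Vᴴ, g2, Matrix.one_mul, h2]
  · simp only [conjTranspose_mul, Matrix.mul_assoc]

theorem UEquiv.submatrix (A : Matrix κ κ ℂ) (e : ι ≃ κ) : UEquiv A (A.submatrix e e) := by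
  refine ⟨(1 : Matrix κ κ ℂ).submatrix e id, ?_, ?_, ?_⟩
  · have := submatrix_mul_equiv (1 : Matrix κ κ ℂ) (1 : Matrix κ κ ℂ) e (Equiv.refl κ) e
    simpa [conjTranspose_submatrix] using this
  · rw [conjTranspose_submatrix, submatrix_mul_equiv]
    simp
  · have : A.submatrix e e = (1 * A * 1 : Matrix κ κ ℂ).submatrix e e := by simp
    rw [this, ← submatrix_mul_equiv _ _ _ (Equiv.refl κ), ← submatrix_mul_equiv _ _ _ (Equiv.refl κ)]
    simp [conjTranspose_submatrix]

/-- Conjugating the two diagonal blocks separately. -/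
theorem UEquiv.diagBlocks {A : Matrix κ κ ℂ} {A' : Matrix ι ι ℂ} {D : Matrix κ' κ' ℂ}
    {D' : Matrix ι' ι' ℂ} (h : UEquiv A A') (h' : UEquiv D D')
    (B : Matrix κ κ' ℂ) (C : Matrix κ' κ ℂ) :
    ∃ B' C', UEquiv (fromBlocks A B C D) (fromBlocks A' B' C' D') := by
  obtain ⟨U, h1, h2, rfl⟩ := h
  obtain ⟨V, g1, g2, rfl⟩ := h'
  refine ⟨U * B * Vᴴ, V * C * Uᴴ, fromBlocks U 0 0 V, ?_, ?_, ?_⟩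
  · simp [fromBlocks_conjTranspose, fromBlocks_multiply, h1, g1]
  · simp [fromBlocks_conjTranspose, fromBlocks_multiply, h2, g2]
  · simp [fromBlocks_conjTranspose, fromBlocks_multiply]

theorem UEquiv.directSum {A : Matrix κ κ ℂ} {A' : Matrix ι ι ℂ} {D : Matrix κ' κ' ℂ}
    {D' : Matrix ι' ι' ℂ} (h : UEquiv A A') (h' : UEquiv D D') :
    UEquiv (fromBlocks A 0 0 D) (fromBlocks A' 0 0 D') := by
  obtain ⟨U, h1, h2, rfl⟩ := h
  obtain ⟨V, g1, g2, rfl⟩ := h'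
  refine ⟨fromBlocks U 0 0 V, ?_, ?_, ?_⟩
  · simp [fromBlocks_conjTranspose, fromBlocks_multiply, h1, g1]
  · simp [fromBlocks_conjTranspose, fromBlocks_multiply, h2, g2]
  · simp [fromBlocks_conjTranspose, fromBlocks_multiply]

theorem UEquiv.realDiagonal_of_multiset_eq {a : κ → ℝ} {b : ι → ℝ}
    (H : ∑ i, ({a i} : Multiset ℝ) = ∑ j, {b j}) :
    UEquiv (realDiagonal a) (realDiagonal b) := by
  obtain ⟨e, he⟩ := exists_equiv_of_multiset_eq H.symm
  have := UEquiv.submatrix (realDiagonal a) e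
  rwa [realDiagonal, submatrix_diagonal_equiv, ← realDiagonal,
    show (fun i => ((a i : ℝ) : ℂ)) ∘ e = fun i => ((b i : ℝ) : ℂ) by ext i; simp [he]] at this

/-- Mixing the modes pairwise: a direct sum of rotations. -/
theorem UEquiv.rotation {a b p : ι → ℝ} (hp : ∀ i, 0 ≤ p i) (hp' : ∀ i, p i ≤ 1) :
    ∃ Y Y', UEquiv (fromBlocks (realDiagonal a) 0 0 (realDiagonal b))
      (fromBlocks (realDiagonal fun i => p i * a i + (1 - p i) * b i) Y Y'
        (realDiagonal fun i => (1 - p i) * a i + p i * b i)) := by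
  set c : ι → ℝ := fun i => √(p i)
  set s : ι → ℝ := fun i => √(1 - p i)
  have hc (i) : ((c i : ℝ) : ℂ) * c i = p i := by
    exact_mod_cast Real.mul_self_sqrt (hp i)
  have hs (i) : ((s i : ℝ) : ℂ) * s i = 1 - p i := by
    exact_mod_cast Real.mul_self_sqrt (sub_nonneg.2 (hp' i))
  have star_c : (realDiagonal c)ᴴ = realDiagonal c := by simp [realDiagonal, Pi.star_def]
  have star_s : (realDiagonal s)ᴴ = realDiagonal s := by simp [realDiagonal, Pi.star_def]
  let y : ι → ℝ := fun i => c i * s i * (b i - a i)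
  refine ⟨realDiagonal y, realDiagonal y,
    fromBlocks (realDiagonal c) (realDiagonal s) (-realDiagonal s) (realDiagonal c),
    ?_, ?_, ?_⟩
  · rw [fromBlocks_conjTranspose, fromBlocks_multiply, ← fromBlocks_one]
    simp only [conjTranspose_neg, star_c, star_s]
    simp [realDiagonal, hc, hs, mul_comm]
  · rw [fromBlocks_conjTranspose, fromBlocks_multiply, ← fromBlocks_one]
    simp only [conjTranspose_neg, star_c, star_s]
    simp [realDiagonal, hc, hs, mul_comm]
  · rw [fromBlocks_conjTranspose, fromBlocks_multiply, fromBlocks_multiply]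
    simp only [conjTranspose_neg, star_c, star_s]
    congr 1
    · simp only [realDiagonal, diagonal_mul_diagonal, Matrix.mul_zero, add_zero, zero_add,
        diagonal_add]
      congr 1
      ext i
      push_cast
      linear_combination -(a i : ℂ) * hc i - (b i : ℂ) * hs i
    · simp only [realDiagonal, diagonal_mul_diagonal, Matrix.mul_zero, add_zero, zero_add,
        diagonal_add, diagonal_neg]
      congr 1
      ext i
      simp only [y]
      push_cast
      ring
    · simp only [realDiagonal, diagonal_mul_diagonal, Matrix.mul_zero, add_zero, zero_add,
        diagonal_add, diagonal_neg]
      congr 1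
      ext i
      simp only [y]
      push_cast
      ring
    · simp only [realDiagonal, diagonal_mul_diagonal, Matrix.mul_zero, add_zero, zero_add,
        diagonal_add, Matrix.neg_mul, Matrix.mul_neg, neg_neg]
      congr 1
      ext i
      push_cast
      linear_combination -(a i : ℂ) * hs i - (b i : ℂ) * hc i

/-- Each diagonal entry is an average of the eigenvalues, with bistochastic weights. -/
theorem UEquiv.sum_convex_le {a : κ → ℝ} {B : Matrix ι ι ℂ} (h : UEquiv (realDiagonal a) B)
    {φ : ℝ → ℝ} (hφ : ConvexOn ℝ Set.univ φ) : ∑ i, φ (B i i).re ≤ ∑ j, φ (a j) := by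
  obtain ⟨U, h1, h2, rfl⟩ := h
  set w : ι → κ → ℝ := fun i j => Complex.normSq (U i j)
  have row (i) : ∑ j, w i j = 1 := by
    have := congrFun (congrFun h1 i) i
    simp only [mul_apply, conjTranspose_apply, one_apply_eq] at this
    have := congrArg Complex.re this
    simpa [w, Complex.normSq_apply] using this
  have col (j) : ∑ i, w i j = 1 := by
    have := congrFun (congrFun h2 j) j
    simp only [mul_apply, conjTranspose_apply, one_apply_eq] at this
    have := congrArg Complex.re this
    simpa [w, Complex.normSq_apply] using this
  have entry (i) : ((U * realDiagonal a * Uᴴ) i i).re = ∑ j, w i j * a j := by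
    rw [mul_apply, Complex.re_sum]
    simp only [realDiagonal, mul_diagonal, conjTranspose_apply]
    refine Finset.sum_congr rfl fun j _ => ?_
    simp [w, Complex.normSq_apply]
    ring
  -- Row sums equal to 1 allow Jensen's inequality; column sums equal to 1 then collapse the double
  -- sum.
  calc ∑ i, φ ((U * realDiagonal a * Uᴴ) i i).re
      ≤ ∑ i, ∑ j, w i j * φ (a j) := by
        refine Finset.sum_le_sum fun i _ => ?_
        rw [entry]
        exact hφ.map_sum_le (fun j _ => Complex.normSq_nonneg _) (row i) (by simp)
    _ = ∑ j, φ (a j) := by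
        rw [Finset.sum_comm]
        exact Finset.sum_congr rfl fun j _ => by rw [← Finset.sum_mul, col, one_mul]

/-- Spectral theorem, with the eigenvalues in non-increasing order. -/
theorem UEquiv.realDiagonal_eigenvalueVector {n : ℕ} {M : Matrix (Fin n) (Fin n) ℂ}
    (hM : M.IsHermitian) : UEquiv M (realDiagonal (eigenvalueVector hM)) := by
  have h : UEquiv (realDiagonal hM.eigenvalues) M := by
    refine ⟨hM.eigenvectorUnitary, ?_, ?_, ?_⟩
    · exact Unitary.coe_mul_star_self hM.eigenvectorUnitary
    · exact Unitary.coe_star_mul_self hM.eigenvectorUnitary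
    · conv_lhs => rw [hM.spectral_theorem, Unitary.conjStarAlgAut_apply]
      rfl
  refine h.symm.trans (UEquiv.realDiagonal_of_multiset_eq ?_)
  let e : Fin n ≃ Fin (Fintype.card (Fin n)) := finCongr (Fintype.card_fin n).symm
  rw [← Equiv.sum_comp (e.trans (Fintype.equivOfCardEq (Fintype.card_fin _)))]
  simp [IsHermitian.eigenvalues, eigenvalueVector, e]

theorem eigenvalueVector_antitone {n : ℕ} {M : Matrix (Fin n) (Fin n) ℂ}
    (hM : M.IsHermitian) : Antitone (eigenvalueVector hM) := fun _ _ h =>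
  hM.eigenvalues₀_antitone (by simpa using h)

end UnitaryEquivalence

/-! ### Covariance matrices and passive maps in ladder coordinates -/

/-- The coefficients `(1, i)` of the unnormalised ladder operators `x + i p`. -/
def ladder (ι : Type*) [DecidableEq ι] : Matrix ι (ι ⊕ ι) ℂ :=
  fromCols 1 (Complex.I • (1 : Matrix ι ι ℂ))

/-- A real matrix with complex entries. -/
abbrev complexify {ι κ : Type*} (A : Matrix ι κ ℝ) : Matrix ι κ ℂ := A.map Complex.ofRealHom

section EntryFormulas

variable {ι κ : Type*}

theorem complexify_conjTranspose {A : Matrix ι κ ℝ} : (complexify A)ᴴ = complexify Aᵀ := by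
  ext i j
  simp

theorem product_isSymm {σ : Matrix (ι ⊕ ι) (ι ⊕ ι) ℝ} {τ : Matrix (κ ⊕ κ) (κ ⊕ κ) ℝ}
    (hσ : σ.IsSymm) (hτ : τ.IsSymm) : (product σ τ).IsSymm :=
  IsSymm.submatrix (by simp [IsSymm, fromBlocks_transpose, hσ.eq, hτ.eq]) _

variable [DecidableEq ι]

theorem ladder_conjTranspose :
    (ladder ι)ᴴ = fromRows 1 (-Complex.I • (1 : Matrix ι ι ℂ)) := by
  simp [ladder, conjTranspose_fromCols_eq_fromRows_conjTranspose, conjTranspose_smul]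

theorem complexify_J : complexify (J ι ℝ) = J ι ℂ := map_J ι Complex.ofRealHom

theorem modeMatrix_thermalCovariance (β ω : ℝ) :
    modeMatrix β ω (thermalCovariance β ω ι) = 0 := by
  ext i j
  by_cases h : i = j <;> simp [modeMatrix, thermalCovariance, one_apply, h]

variable [DecidableEq κ]

theorem modeMatrix_product (β ω : ℝ) (σ : Matrix (ι ⊕ ι) (ι ⊕ ι) ℝ)
    (τ : Matrix (κ ⊕ κ) (κ ⊕ κ) ℝ) :
    modeMatrix β ω (product σ τ) = fromBlocks (modeMatrix β ω σ) 0 0 (modeMatrix β ω τ) := by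
  ext (i | i) (j | j) <;> simp [modeMatrix, product]

theorem modeMatrix_reduced (β ω : ℝ) {f : κ → ι} (hf : Function.Injective f)
    (σ : Matrix (ι ⊕ ι) (ι ⊕ ι) ℝ) :
    modeMatrix β ω (reduced f σ) = (modeMatrix β ω σ).submatrix f f := by
  ext i j
  simp [modeMatrix, reduced, hf.eq_iff]

end EntryFormulas

section Covariance

variable {ι κ : Type*} [Fintype ι] [Fintype κ] [DecidableEq ι] [DecidableEq κ]

theorem ladder_mul_conjTranspose : ladder ι * (ladder ι)ᴴ = (2 : ℂ) • 1 := by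
  rw [ladder_conjTranspose, ladder, fromCols_mul_fromRows]
  simp [smul_smul, two_smul]

/-- Half of this matrix is the orthogonal projection onto the eigenspace of `J` for the eigenvalue
`i`. Hence a matrix commuting with `J` acts on the ladder operators among themselves. -/
theorem conjTranspose_mul_ladder : (ladder ι)ᴴ * ladder ι = 1 - Complex.I • J ι ℂ := by
  rw [ladder_conjTranspose, ladder, fromRows_mul_fromCols]
  ext (i | i) (j | j) <;> simp [J, one_apply]
  split_ifs <;> simp

theorem ladder_mul_J : ladder ι * J ι ℂ = Complex.I • ladder ι := by
  rw [ladder, J, fromCols_mul_fromBlocks]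
  ext i (j | j) <;> simp [one_apply]
  split_ifs <;> simp

theorem modeMatrix_eq_ladder (β ω : ℝ) {σ : Matrix (ι ⊕ ι) (ι ⊕ ι) ℝ} (hσ : σ.IsSymm) :
    modeMatrix β ω σ = (1 / 2 : ℂ) • (ladder ι * complexify σ * (ladder ι)ᴴ)
      - (thermalVariance β ω : ℂ) • 1 := by
  rw [ladder_conjTranspose, ladder, ← fromBlocks_toBlocks (complexify σ),
    fromCols_mul_fromBlocks, fromCols_mul_fromRows]
  ext i j
  have := hσ.apply (.inr i) (.inl j)
  simp [modeMatrix, toBlocks₁₁, toBlocks₁₂, toBlocks₂₁, toBlocks₂₂, one_apply, this]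
  ring_nf
  simp
  ring

theorem modeMatrix_isHermitian (β ω : ℝ) {σ : Matrix (ι ⊕ ι) (ι ⊕ ι) ℝ} (hσ : σ.IsSymm) :
    (modeMatrix β ω σ).IsHermitian := by
  rw [modeMatrix_eq_ladder β ω hσ, IsHermitian]
  simp only [conjTranspose_sub, conjTranspose_smul, conjTranspose_mul, conjTranspose_conjTranspose,
    complexify_conjTranspose, hσ.eq, Matrix.mul_assoc, conjTranspose_one]
  simp

/-- The thermal shift is a multiple of the identity, so unitarity of `U` leaves it unchanged. -/
theorem modeMatrix_conj (β ω : ℝ) {σ S : Matrix (ι ⊕ ι) (ι ⊕ ι) ℝ} (hσ : σ.IsSymm)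
    {U : Matrix ι ι ℂ} (hU : U * Uᴴ = 1) (h : ladder ι * complexify S = U * ladder ι) :
    modeMatrix β ω (S * σ * Sᵀ) = U * modeMatrix β ω σ * Uᴴ := by
  have h' : complexify Sᵀ * (ladder ι)ᴴ = (ladder ι)ᴴ * Uᴴ := by
    rw [← complexify_conjTranspose, ← conjTranspose_mul, h, conjTranspose_mul]
  have symm : (S * σ * Sᵀ).IsSymm := by
    simp [IsSymm, transpose_mul, hσ.eq, Matrix.mul_assoc]
  rw [modeMatrix_eq_ladder β ω symm, modeMatrix_eq_ladder β ω hσ]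
  have : ladder ι * complexify (S * σ * Sᵀ) * (ladder ι)ᴴ
      = U * (ladder ι * complexify σ * (ladder ι)ᴴ) * Uᴴ := by
    simp only [complexify, Matrix.map_mul] at h h' ⊢
    rw [← Matrix.mul_assoc, ← Matrix.mul_assoc, h, Matrix.mul_assoc _ _ (ladder ι)ᴴ, h']
    simp only [Matrix.mul_assoc]
  rw [this]
  simp [Matrix.mul_sub, Matrix.sub_mul, hU]

theorem exists_unitary_of_passive {S : Matrix (ι ⊕ ι) (ι ⊕ ι) ℝ} (hS : S ∈ passive ι) :
    ∃ U : Matrix ι ι ℂ, U * Uᴴ = 1 ∧ ladder ι * complexify S = U * ladder ι := by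
  obtain ⟨h1, h2⟩ := Submonoid.mem_inf.1 hS
  rw [SymplecticGroup.mem_iff] at h1
  have h2' : Sᵀ * S = 1 := (mem_orthogonalGroup_iff' _ _).1 h2
  have h2 : S * Sᵀ = 1 := (mem_orthogonalGroup_iff _ _).1 h2
  -- Orthogonality turns `S J Sᵀ = J` into commutation with `J`, so no creation operators are mixed
  -- in.
  have comm : S * J ι ℝ = J ι ℝ * S := by
    have := congrArg (· * S) h1
    simpa only [Matrix.mul_assoc, h2', Matrix.mul_one] using this
  have comm' : complexify S * J ι ℂ = J ι ℂ * complexify S := by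
    rw [← complexify_J, ← Matrix.map_mul, comm, Matrix.map_mul]
  have h : ladder ι * complexify S =
      ((1 / 2 : ℂ) • (ladder ι * complexify S * (ladder ι)ᴴ)) * ladder ι := by
    rw [Matrix.smul_mul, Matrix.mul_assoc _ _ (ladder ι), conjTranspose_mul_ladder, Matrix.mul_sub,
      Matrix.mul_smul, Matrix.mul_assoc (ladder ι) _ (J ι ℂ), comm', ← Matrix.mul_assoc, ladder_mul_J,
      Matrix.smul_mul, smul_smul, Matrix.mul_one, Complex.I_mul_I, neg_one_smul, sub_neg_eq_add,
      ← two_smul ℂ, smul_smul]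
    simp
  refine ⟨_, ?_, h⟩
  generalize (1 / 2 : ℂ) • (ladder ι * complexify S * (ladder ι)ᴴ) = U at h ⊢
  have h3 : (U * ladder ι) * (U * ladder ι)ᴴ = (2 : ℂ) • 1 := by
    rw [← h, conjTranspose_mul, complexify_conjTranspose, Matrix.mul_assoc,
      ← Matrix.mul_assoc (complexify S), ← Matrix.map_mul, h2]
    simp [ladder_mul_conjTranspose]
  rw [conjTranspose_mul, Matrix.mul_assoc, ← Matrix.mul_assoc (ladder ι),
    ladder_mul_conjTranspose, Matrix.smul_mul, Matrix.one_mul, Matrix.mul_smul] at h3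
  have := congrArg ((1 / 2 : ℂ) • ·) h3
  simpa [smul_smul] using this

/-- The real form of `U = A + i C` is the block matrix with rows `(A, -C)` and `(C, A)`; it commutes
with `J`, and unitarity of `U` makes it orthogonal. -/
theorem exists_passive_of_unitary {U : Matrix ι ι ℂ} (hU : U * Uᴴ = 1) :
    ∃ S ∈ passive ι, ladder ι * complexify S = U * ladder ι := by
  set A : Matrix ι ι ℝ := U.map Complex.re
  set C : Matrix ι ι ℝ := U.map Complex.im
  have hre : A * Aᵀ + C * Cᵀ = 1 := by
    ext i j
    have := congrArg Complex.re (congrFun (congrFun hU i) j)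
    simp only [mul_apply, Complex.re_sum, conjTranspose_apply] at this
    simp only [Matrix.add_apply, mul_apply, transpose_apply, ← Finset.sum_add_distrib]
    convert this using 1
    · simp [A, C]
    · by_cases hij : i = j <;> simp [one_apply, hij]
  have him : C * Aᵀ = A * Cᵀ := by
    ext i j
    have := congrArg Complex.im (congrFun (congrFun hU i) j)
    simp only [mul_apply, Complex.im_sum, conjTranspose_apply] at this
    rw [← sub_eq_zero]
    simp only [mul_apply, transpose_apply, ← Finset.sum_sub_distrib]
    convert this using 1
    · refine Finset.sum_congr rfl fun k _ => ?_
      simp [A, C]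
      ring
    · by_cases hij : i = j <;> simp [one_apply, hij]
  have orth : fromBlocks A (-C) C A * (fromBlocks A (-C) C A)ᵀ = 1 := by
    rw [fromBlocks_transpose, fromBlocks_multiply, ← fromBlocks_one]
    simp [hre, him, add_comm (C * Cᵀ)]
  refine ⟨fromBlocks A (-C) C A, Submonoid.mem_inf.2 ⟨?_, (mem_orthogonalGroup_iff _ _).2 orth⟩, ?_⟩
  · have comm : fromBlocks A (-C) C A * J ι ℝ = J ι ℝ * fromBlocks A (-C) C A := by
      simp [J, fromBlocks_multiply]
    rw [SymplecticGroup.mem_iff, comm, Matrix.mul_assoc, orth, Matrix.mul_one]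
  · rw [complexify, fromBlocks_map, ladder, fromCols_mul_fromBlocks, mul_fromCols]
    have : complexify A + Complex.I • complexify C = U := by
      ext i j
      simp [A, C, mul_comm Complex.I, Complex.re_add_im]
    conv_rhs => rw [← this]
    ext i (j | j)
    · simp
    · simp [← mul_assoc]
      ring

open scoped ComplexOrder in
theorem modeMatrix_add_posSemidef (β ω : ℝ) {σ : Matrix (ι ⊕ ι) (ι ⊕ ι) ℝ}
    (hσ : IsCovarianceMatrix σ) :
    (modeMatrix β ω σ + ((thermalVariance β ω - 1 / 2 : ℝ) : ℂ) • 1).PosSemidef := by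
  obtain ⟨symm, pos⟩ := hσ
  -- Transposition flips the sign of the symplectic form. This sign yields the normally ordered
  -- moments, hence the bound with `- 1 / 2`.
  have h1 : (complexify σ + (Complex.I / 2) • J ι ℂ).PosSemidef := by
    have : complexify σ + (Complex.I / 2) • J ι ℂ = (σ.map Complex.ofReal +
        (Complex.I / 2) • (symplecticForm ι).map Complex.ofReal)ᵀ := by
      rw [transpose_add, transpose_smul, ← transpose_map, symm.eq, ← transpose_map]
      congr 2
      simp [symplecticForm, J, fromBlocks_transpose, fromBlocks_map, Matrix.map_neg]
    rw [this]
    exact pos.transpose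
  have h2 := (h1.mul_mul_conjTranspose_same (ladder ι)).smul (show (0 : ℝ) ≤ 1 / 2 by norm_num)
  convert h2 using 1
  rw [modeMatrix_eq_ladder β ω symm, Matrix.mul_add, Matrix.mul_smul, ladder_mul_J, Matrix.add_mul,
    smul_smul, Matrix.smul_mul, ladder_mul_conjTranspose, smul_smul]
  ext i j
  simp
  ring_nf
  simp
  ring

open scoped ComplexOrder in
theorem UEquiv.neg_le_of_posSemidef {A : Matrix κ κ ℂ} {a : ι → ℝ}
    (h : UEquiv A (realDiagonal a)) {t : ℝ} (ht : (A + (t : ℂ) • 1).PosSemidef) (i : ι) :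
    -t ≤ a i := by
  obtain ⟨U, h1, -, h⟩ := h
  have := (ht.mul_mul_conjTranspose_same U).diag_nonneg (i := i)
  rw [Matrix.mul_add, Matrix.add_mul, ← h, Matrix.mul_smul, Matrix.mul_one, Matrix.smul_mul, h1] at this
  simp only [realDiagonal, Matrix.add_apply, diagonal_apply_eq, Matrix.smul_apply, one_apply_eq, smul_eq_mul,
    mul_one] at this
  have : 0 ≤ a i + t := by exact_mod_cast this
  linarith

open scoped ComplexOrder in
theorem exists_covariance_realDiagonal (β ω : ℝ) {γ : ι → ℝ}
    (hγ : ∀ i, -(thermalVariance β ω - 1 / 2) ≤ γ i) :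
    ∃ σ : Matrix (ι ⊕ ι) (ι ⊕ ι) ℝ, IsCovarianceMatrix σ ∧
      modeMatrix β ω σ = realDiagonal γ := by
  set g : ι ⊕ ι → ℝ := fun i => Sum.elim γ γ i + thermalVariance β ω
  refine ⟨diagonal g, ⟨isSymm_diagonal g, ?_⟩, ?_⟩
  · have h1 : (realDiagonal fun i => g i - 1 / 2).PosSemidef := by
      rw [realDiagonal, posSemidef_diagonal_iff]
      rintro (i | i) <;>
      · have := hγ i
        exact_mod_cast (by simp [g]; linarith : 0 ≤ g _ - 1 / 2)
    -- Half of `(ladder ι)ᴴ * ladder ι` is `1/2 + (i/2) Ω`, the uncertainty matrix of the vacuum;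
    -- the remainder is diagonal.
    have h2 := (posSemidef_conjTranspose_mul_self (ladder ι)).smul
      (show (0 : ℝ) ≤ 1 / 2 by norm_num)
    convert h1.add h2 using 1
    rw [conjTranspose_mul_ladder]
    have : (symplecticForm ι).map Complex.ofReal = -J ι ℂ := by
      simp [symplecticForm, J, fromBlocks_map, fromBlocks_neg, Matrix.map_neg]
    rw [this]
    ext i j
    by_cases h : i = j
    · subst h
      simp [realDiagonal]
      ring
    · simp [realDiagonal, h]
      ring
  · ext i j
    by_cases h : i = j <;> simp [modeMatrix, realDiagonal, g, h]

end Covariance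

/-! ### Catalytic transformations as unitary equivalences of block matrices -/

section WeakCatalytic

variable {β ω : ℝ} {n c b : ℕ} {σ : Matrix (Fin n ⊕ Fin n) (Fin n ⊕ Fin n) ℝ}
  {M' : Matrix (Fin n) (Fin n) ℂ}

theorem weakCatalytic_of_uequiv (hσ : σ.IsSymm) {γ : Fin c → ℝ}
    (hγ : ∀ i, -(thermalVariance β ω - 1 / 2) ≤ γ i) {Y : Matrix (Fin n) (Fin c) ℂ}
    {Y' : Matrix (Fin c) (Fin n) ℂ} {B : Matrix (Fin n ⊕ Fin c) (Fin b) ℂ}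
    {C : Matrix (Fin b) (Fin n ⊕ Fin c) ℂ} {E : Matrix (Fin b) (Fin b) ℂ}
    (h : UEquiv (fromBlocks (fromBlocks (modeMatrix β ω σ) 0 0 (realDiagonal γ)) 0 0
        (0 : Matrix (Fin b) (Fin b) ℂ))
      (fromBlocks (fromBlocks M' Y Y' (realDiagonal γ)) B C E)) :
    WeakCatalytic β ω c b σ M' := by
  obtain ⟨σC, hσC, hMC⟩ := exists_covariance_realDiagonal β ω hγ
  obtain ⟨U, hU, -, hH⟩ := h
  obtain ⟨S, hS, hSU⟩ := exists_passive_of_unitary hU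
  have key := modeMatrix_conj β ω (product_isSymm (product_isSymm hσ hσC.1)
    (show (thermalCovariance β ω (Fin b)).IsSymm by simp [thermalCovariance, IsSymm])) hU hSU
  rw [modeMatrix_product, modeMatrix_product, modeMatrix_thermalCovariance, hMC, ← hH] at key
  refine ⟨σC, hσC, _, ⟨S, hS, rfl⟩, ?_, ?_⟩
  · rw [modeMatrix_reduced _ _ Sum.inl_injective, modeMatrix_reduced _ _ Sum.inl_injective, key]
    rfl
  · rw [modeMatrix_reduced _ _ Sum.inr_injective, modeMatrix_reduced _ _ Sum.inl_injective, key,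
      hMC]
    rfl

theorem WeakCatalytic.exists_uequiv (h : WeakCatalytic β ω c b σ M') (hσ : σ.IsSymm) :
    ∃ MC : Matrix (Fin c) (Fin c) ℂ, MC.IsHermitian ∧ ∃ Y Y' B C E,
      UEquiv (fromBlocks (fromBlocks (modeMatrix β ω σ) 0 0 MC) 0 0 (0 : Matrix (Fin b) (Fin b) ℂ))
        (fromBlocks (fromBlocks M' Y Y' MC) B C (E : Matrix (Fin b) (Fin b) ℂ)) := by
  obtain ⟨σC, hσC, _, ⟨S, hS, rfl⟩, h1, h2⟩ := h
  obtain ⟨U, hU, hSU⟩ := exists_unitary_of_passive hS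
  have key := modeMatrix_conj β ω (product_isSymm (product_isSymm hσ hσC.1)
    (show (thermalCovariance β ω (Fin b)).IsSymm by simp [thermalCovariance, IsSymm])) hU hSU
  rw [modeMatrix_product, modeMatrix_product, modeMatrix_thermalCovariance] at key
  rw [modeMatrix_reduced _ _ Sum.inl_injective, modeMatrix_reduced _ _ Sum.inl_injective, key]
    at h1
  rw [modeMatrix_reduced _ _ Sum.inr_injective, modeMatrix_reduced _ _ Sum.inl_injective, key]
    at h2
  refine ⟨modeMatrix β ω σC, modeMatrix_isHermitian β ω hσC.1, ?_⟩
  rw [← h1]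
  set H := U * fromBlocks (fromBlocks (modeMatrix β ω σ) 0 0 (modeMatrix β ω σC)) 0 0
    (0 : Matrix (Fin b) (Fin b) ℂ) * Uᴴ with hH
  refine ⟨H.toBlocks₁₁.toBlocks₁₂, H.toBlocks₁₁.toBlocks₂₁, H.toBlocks₁₂, H.toBlocks₂₁,
    H.toBlocks₂₂, U, hU, mul_eq_one_comm.1 hU, ?_⟩
  rw [← hH]
  conv_rhs => rw [← fromBlocks_toBlocks H, ← fromBlocks_toBlocks H.toBlocks₁₁]
  congr 2
  exact h2.symm

end WeakCatalytic

/-! ### Majorisation: pairwise averaging and truncation -/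

section Majorisation

/-- Replacing two consecutive terms of a sequence by a single one. -/
theorem sum_range_merge {A : Type*} [AddCommMonoid A] (g : ℝ → A) (v : ℕ → ℝ) (r : ℝ) {j N : ℕ}
    (hj : j + 1 ≤ N) :
    ∑ i ∈ Finset.range (N + 1), g (v i) + g r =
      ∑ i ∈ Finset.range N, g (if i < j then v i else if i = j then r else v (i + 1))
        + (g (v j) + g (v (j + 1))) := by
  induction N, hj using Nat.le_induction with
  | base =>
    have : ∑ i ∈ Finset.range j, g (if i < j then v i else if i = j then r else v (i + 1)) =
        ∑ i ∈ Finset.range j, g (v i) :=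
      Finset.sum_congr rfl fun i hi => by rw [if_pos (Finset.mem_range.1 hi)]
    rw [Finset.sum_range_succ _ (j + 1), Finset.sum_range_succ _ j, Finset.sum_range_succ _ j, this]
    simp only [lt_irrefl, if_false, if_true]
    abel
  | succ N hN ih =>
    rw [Finset.sum_range_succ, add_right_comm, ih, Finset.sum_range_succ _ N,
      if_neg (by omega), if_neg (by omega), add_right_comm]

/-- If `v` majorises `u`, then `u` arises from `v` by successive averagings of pairs: the pair
`(a k, b k)` is averaged to the final entry `u k` and to the auxiliary entry `γ k`, which takes
the place of `a k` and `b k` afterwards. -/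
theorem exists_pairwise_averaging (m : ℕ) : ∀ u v : ℕ → ℝ, Antitone u → Antitone v →
    (∀ k ≤ m + 1, ∑ i ∈ Finset.range k, u i ≤ ∑ i ∈ Finset.range k, v i) →
    ∑ i ∈ Finset.range (m + 1), u i = ∑ i ∈ Finset.range (m + 1), v i →
    ∃ a b γ p : Fin m → ℝ, (∀ k, 0 ≤ p k) ∧ (∀ k, p k ≤ 1) ∧
      (∀ k : Fin m, u k = p k * a k + (1 - p k) * b k) ∧ (∀ k, γ k = (1 - p k) * a k + p k * b k) ∧
      ∑ k, ({a k} : Multiset ℝ) + ∑ k, {b k} + {u m} =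
        ∑ i ∈ Finset.range (m + 1), {v i} + ∑ k, {γ k} ∧
      ∀ L, (∀ i ≤ m, L ≤ v i) → ∀ k, L ≤ γ k := by
  induction m with
  | zero =>
    intro u v _ _ _ h
    refine ⟨0, 0, 0, 0, by simp, by simp, by simp, by simp, ?_, by simp⟩
    simpa using h
  | succ m ih =>
    intro u v hu hv hle heq
    have h0 : u 0 ≤ v 0 := by simpa using hle 1 (by omega)
    -- The least entry of `v` is at most the common average, which is at most the largest entry of
    -- `u`.
    have hlast : v (m + 1) ≤ u 0 := by
      have h1 : ∑ i ∈ Finset.range (m + 2), u i ≤ (m + 2) * u 0 := by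
        simpa using Finset.sum_le_card_nsmul (Finset.range (m + 2)) u (u 0)
          fun i _ => hu (Nat.zero_le i)
      have h2 : (m + 2) * v (m + 1) ≤ ∑ i ∈ Finset.range (m + 2), v i := by
        simpa using Finset.card_nsmul_le_sum (Finset.range (m + 2)) v (v (m + 1))
          fun i hi => hv (by have := Finset.mem_range.1 hi; omega)
      have h3 : (m + 2 : ℝ) * v (m + 1) ≤ (m + 2) * u 0 := by linarith
      exact le_of_mul_le_mul_left h3 (by positivity)
    -- The first crossing of the level `u 0` by `v`; minimality of `j` gives `u 0 ≤ v j`.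
    obtain ⟨j, hjm, hja, hjb⟩ : ∃ j ≤ m, u 0 ≤ v j ∧ v (j + 1) ≤ u 0 := by
      have ex : ∃ j, v (j + 1) ≤ u 0 := ⟨m, hlast⟩
      classical
      refine ⟨Nat.find ex, Nat.find_min' ex hlast, ?_, Nat.find_spec ex⟩
      rcases h : Nat.find ex with _ | j
      · exact h0
      · exact le_of_not_ge (Nat.find_min ex (m := j) (by omega))
    -- The by-product keeps the pair's sum and lies between `v (j + 1)` and `v j`, so putting it in
    -- their place keeps the list sorted.
    set r := v j + v (j + 1) - u 0 with hr
    set w : ℕ → ℝ := fun i => if i < j then v i else if i = j then r else v (i + 1) with hw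
    have hv_step (i) : v (i + 1) ≤ v i := hv (Nat.le_succ i)
    have w_anti : Antitone w := by
      refine antitone_nat_of_succ_le fun i => ?_
      have := hv_step i
      have := hv_step (i + 1)
      rcases lt_trichotomy (i + 1) j with h | h | h
      · simp [hw, h, show i < j by omega]
        linarith
      · subst h
        simp [hw]
        linarith
      · by_cases hij : i = j
        · subst hij
          simp [hw]
          linarith
        · simp [hw, show ¬ i + 1 < j by omega, show ¬ i + 1 = j by omega, show ¬ i < j by omega,
            hij]
          linarith
    have w_sum {k : ℕ} (hk : j + 1 ≤ k) :
        ∑ i ∈ Finset.range k, w i = ∑ i ∈ Finset.range (k + 1), v i - u 0 := by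
      have := sum_range_merge id v r hk
      simp only [id] at this
      linarith
    obtain ⟨a, b, γ, p, hp, hp', hf, hγ, hms, hL⟩ := ih (fun i => u (i + 1)) w
      (fun i k h => hu (by omega)) w_anti
      (fun k hk => by
        -- Before the merge, shifting `u` only lowers its sums; beyond it, both sides are the
        -- original sums of `k + 1` terms less `u 0`.
        by_cases hkj : k ≤ j
        · calc ∑ i ∈ Finset.range k, u (i + 1) ≤ ∑ i ∈ Finset.range k, u i :=
              Finset.sum_le_sum fun i _ => hu (Nat.le_succ i)
            _ ≤ ∑ i ∈ Finset.range k, v i := hle k (by omega)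
            _ = ∑ i ∈ Finset.range k, w i := Finset.sum_congr rfl fun i hi => by
              simp [hw, show i < j by have := Finset.mem_range.1 hi; omega]
        · rw [w_sum (by omega)]
          have := hle (k + 1) (by omega)
          rw [Finset.sum_range_succ'] at this
          linarith)
      (by
        rw [w_sum (by omega)]
        rw [Finset.sum_range_succ'] at heq
        linarith)
    obtain ⟨q, hq, hq', hqf⟩ : ∃ q : ℝ, 0 ≤ q ∧ q ≤ 1 ∧ u 0 = q * v j + (1 - q) * v (j + 1) := by
      rcases eq_or_ne (v j) (v (j + 1)) with h | h
      · exact ⟨0, le_rfl, zero_le_one, by linarith⟩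
      · have hpos : 0 < v j - v (j + 1) := sub_pos.2 (lt_of_le_of_ne (hv_step j) h.symm)
        refine ⟨(u 0 - v (j + 1)) / (v j - v (j + 1)), div_nonneg (by linarith) hpos.le,
          (div_le_one hpos).2 (by linarith), ?_⟩
        field_simp
        ring
    refine ⟨Fin.cons (v j) a, Fin.cons (v (j + 1)) b, Fin.cons r γ, Fin.cons q p, ?_, ?_, ?_, ?_,
      ?_, ?_⟩
    · exact Fin.cases (by simpa) (by simpa)
    · exact Fin.cases (by simpa) (by simpa)
    · exact Fin.cases (by simpa) (by simpa using hf)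
    · refine Fin.cases ?_ (by simpa using hγ)
      simp only [Fin.cons_zero]
      rw [hr, hqf]
      ring
    · have h1 := sum_range_merge (fun x => ({x} : Multiset ℝ)) v r (show j + 1 ≤ m + 1 by omega)
      simp only [Fin.sum_univ_succ, Fin.cons_zero, Fin.cons_succ]
      calc _ = ∑ k, {a k} + ∑ k, {b k} + {u (m + 1)} + ({v j} + {v (j + 1)}) := by abel
        _ = ∑ i ∈ Finset.range (m + 1), {w i} + ({v j} + {v (j + 1)}) + ∑ k, {γ k} := by
          rw [hms, add_right_comm]
        _ = _ := by rw [← h1, add_assoc]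
    · intro L hLv
      have hLr : L ≤ r := by
        have := hLv (j + 1) (by omega)
        linarith
      refine Fin.cases (by simpa) fun k => ?_
      simp only [Fin.cons_succ]
      refine hL L (fun i hi => ?_) k
      simp only [hw]
      split_ifs
      · exact hLv i (by omega)
      · exact hLr
      · exact hLv (i + 1) (by omega)

variable {n : ℕ}

/-- The sum of the first `k` entries. -/
def partialSum (x : Fin n → ℝ) (k : ℕ) : ℝ := ∑ i : Fin n, if (i : ℕ) < k then x i else 0

theorem partialSum_zero (x : Fin n → ℝ) : partialSum x 0 = 0 := by simp [partialSum]

theorem partialSum_last (x : Fin n → ℝ) : partialSum x n = ∑ i, x i := by simp [partialSum]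

theorem partialSum_succ (x : Fin n → ℝ) {k : ℕ} (hk : k < n) :
    partialSum x (k + 1) = partialSum x k + x ⟨k, hk⟩ := by
  have : x ⟨k, hk⟩ = ∑ i : Fin n, if i = ⟨k, hk⟩ then x i else 0 := by simp
  rw [this, partialSum, partialSum, ← Finset.sum_add_distrib]
  refine Finset.sum_congr rfl fun i _ => ?_
  simp only [Fin.ext_iff]
  split_ifs <;> first | omega | simp

theorem partialSum_sub (x y : Fin n → ℝ) (k : ℕ) :
    partialSum (fun i => x i - y i) k = partialSum x k - partialSum y k := by
  rw [partialSum, partialSum, partialSum, ← Finset.sum_sub_distrib]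
  refine Finset.sum_congr rfl fun i _ => ?_
  split_ifs <;> simp

theorem partialSum_rev (x : Fin n → ℝ) {k : ℕ} (hk : k ≤ n) :
    partialSum (fun i => x i.rev) k = ∑ i, x i - partialSum x (n - k) := by
  rw [partialSum, partialSum, ← Finset.sum_sub_distrib, ← Equiv.sum_comp Fin.revPerm]
  refine Finset.sum_congr rfl fun i _ => ?_
  simp only [Fin.revPerm_apply, Fin.rev_rev, Fin.val_rev]
  split_ifs <;> first | omega | simp

theorem partialSum_mono {x : Fin n → ℝ} (hx : ∀ i, 0 ≤ x i) : Monotone (partialSum x) := by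
  intro k l hkl
  refine Finset.sum_le_sum fun i _ => ?_
  split_ifs <;> first | omega | simp [hx i]

theorem sum_Iic_eq_partialSum (x : Fin n → ℝ) (k : Fin n) :
    ∑ i ∈ Finset.Iic k, x i = partialSum x (k + 1) := by
  have : Finset.Iic k = Finset.univ.filter fun i : Fin n => (i : ℕ) < k + 1 := by
    ext i
    rw [Finset.mem_Iic, Finset.mem_filter_univ, Fin.le_def, Nat.lt_succ_iff]
  rw [partialSum, ← Finset.sum_filter, this]

theorem weaklyMajorised_iff {x y : Fin n → ℝ} :
    WeaklyMajorised x y ↔ ∀ k ≤ n, partialSum x k ≤ partialSum y k := by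
  simp only [WeaklyMajorised, sum_Iic_eq_partialSum]
  constructor
  · rintro h (_ | k) hk
    · simp [partialSum_zero]
    · exact h ⟨k, hk⟩
  · exact fun h k => h _ k.2

/-- At the threshold `y k`, the positive parts for `y` are supported on the indices up to `k`, where
they are exact differences. For `x`, dropping terms and positive parts only lowers the sum. -/
theorem weaklyMajorised_of_sum_max_le {x y : Fin n → ℝ} (hy : Antitone y)
    (h : ∀ k, ∑ i, max (x i - y k) 0 ≤ ∑ i, max (y i - y k) 0) : WeaklyMajorised x y := by
  intro k
  have h1 : ∑ i ∈ Finset.Iic k, (x i - y k) ≤ ∑ i, max (x i - y k) 0 :=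
    (Finset.sum_le_sum fun i _ => le_max_left _ _).trans
      (Finset.sum_le_sum_of_subset_of_nonneg (Finset.subset_univ _) fun _ _ _ => le_max_right _ _)
  have h2 : ∑ i, max (y i - y k) 0 = ∑ i ∈ Finset.Iic k, (y i - y k) := by
    rw [← Finset.sum_subset (Finset.subset_univ (Finset.Iic k))]
    · refine Finset.sum_congr rfl fun i hi => max_eq_left ?_
      exact sub_nonneg.2 (hy (Finset.mem_Iic.1 hi))
    · intro i _ hi
      refine max_eq_right (sub_nonpos.2 (hy ?_))
      exact (not_le.1 fun hle => hi (Finset.mem_Iic.2 hle)).le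
  have h3 := h1.trans ((h k).trans h2.le)
  simp only [Finset.sum_sub_distrib] at h3
  linarith

/-- Lowering the smallest entries of `y` so that the total becomes `s`. -/
def truncation (y : Fin n → ℝ) (s : ℝ) (i : Fin n) : ℝ :=
  min (partialSum y (i + 1)) s - min (partialSum y i) s

theorem partialSum_truncation (y : Fin n → ℝ) {s : ℝ} (hs : 0 ≤ s) {k : ℕ} (hk : k ≤ n) :
    partialSum (truncation y s) k = min (partialSum y k) s := by
  induction k with
  | zero => simp [partialSum_zero, hs]
  | succ k ih =>
    rw [partialSum_succ _ hk, ih (by omega), truncation]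
    simp

theorem truncation_nonneg {y : Fin n → ℝ} (hy : ∀ i, 0 ≤ y i) (s : ℝ) (i : Fin n) :
    0 ≤ truncation y s i :=
  sub_nonneg.2 (min_le_min_right s (partialSum_mono hy (Nat.le_succ _)))

theorem truncation_le {y : Fin n → ℝ} (hy : ∀ i, 0 ≤ y i) (s : ℝ) (i : Fin n) :
    truncation y s i ≤ y i := by
  have := hy i
  have h := partialSum_succ y i.2
  simp only [truncation, h, Fin.eta]
  rcases min_cases (partialSum y i + y i) s with h1 | h1 <;>
    rcases min_cases (partialSum y i) s with h2 | h2 <;> linarith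

theorem truncation_antitone {y : Fin n → ℝ} (hy : ∀ i, 0 ≤ y i) (hy' : Antitone y) (s : ℝ) :
    Antitone (truncation y s) := by
  intro i j hij
  have h1 := hy' hij
  have h2 := hy j
  have h3 := partialSum_mono hy (show (i : ℕ) ≤ j from hij)
  simp only [truncation, partialSum_succ y i.2, partialSum_succ y j.2, Fin.eta]
  rcases min_cases (partialSum y i + y i) s with h4 | h4 <;>
    rcases min_cases (partialSum y i) s with h5 | h5 <;>
    rcases min_cases (partialSum y j + y j) s with h6 | h6 <;>
    rcases min_cases (partialSum y j) s with h7 | h7 <;> linarith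

theorem superThermal_antitone {μ : Fin n → ℝ} (h : Antitone μ) : Antitone (superThermal μ) :=
  fun _ _ hij => max_le_max_right 0 (h hij)

theorem subThermal_antitone {μ : Fin n → ℝ} (h : Antitone μ) : Antitone (subThermal μ) :=
  fun _ _ hij => max_le_max_right 0 (neg_le_neg (h (Fin.rev_le_rev.2 hij)))

theorem superThermal_sub_subThermal_rev (μ : Fin n → ℝ) :
    (fun i => superThermal μ i - subThermal μ i.rev) = μ := by
  ext i
  rw [superThermal, subThermal, Fin.rev_rev]
  rcases le_total (μ i) 0 with h | h <;> simp [h]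

/-- Truncation replaces each partial sum of `y` by its minimum with the total of `x`, and the
partial sums of `x` lie below both. -/
theorem WeaklyMajorised.truncation {x y : Fin n → ℝ} (hx : ∀ i, 0 ≤ x i)
    (h : WeaklyMajorised x y) : Majorised x (truncation y (∑ i, x i)) := by
  have hs : 0 ≤ ∑ i, x i := Finset.sum_nonneg fun i _ => hx i
  rw [weaklyMajorised_iff] at h
  refine ⟨weaklyMajorised_iff.2 fun k hk => ?_, ?_⟩
  · rw [partialSum_truncation y hs hk, ← partialSum_last x]
    exact le_min (h k hk) (partialSum_mono hx hk)
  · have := h n le_rfl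
    rw [← partialSum_last (GaussianThermal.truncation _ _), partialSum_truncation y hs le_rfl,
      min_eq_right]
    rwa [partialSum_last x] at this

/-- A partial sum of a reversed vector is the total less a partial sum. As the totals agree,
subtraction restores the direction of the inequality. -/
theorem Majorised.sub_rev {x₁ y₁ x₂ y₂ : Fin n → ℝ} (h₁ : Majorised x₁ y₁)
    (h₂ : Majorised x₂ y₂) :
    Majorised (fun i => x₁ i - x₂ i.rev) (fun i => y₁ i - y₂ i.rev) := by
  obtain ⟨h₁, s₁⟩ := h₁
  obtain ⟨h₂, s₂⟩ := h₂
  rw [weaklyMajorised_iff] at h₁ h₂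
  have sum_rev (x : Fin n → ℝ) : ∑ i : Fin n, x i.rev = ∑ i, x i := Equiv.sum_comp Fin.revPerm x
  refine ⟨weaklyMajorised_iff.2 fun k hk => ?_, ?_⟩
  · rw [partialSum_sub, partialSum_sub, partialSum_rev x₂ hk, partialSum_rev y₂ hk]
    linarith [h₁ k hk, h₂ (n - k) (Nat.sub_le _ _)]
  · rw [Finset.sum_sub_distrib, Finset.sum_sub_distrib, sum_rev, sum_rev, s₁, s₂]

/-- Weak majorisation of the positive and negative parts is majorisation after lowering absolute
values. -/
theorem exists_attenuation {μ μ' : Fin n → ℝ} (hμ : Antitone μ)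
    (hp : WeaklyMajorised (superThermal μ') (superThermal μ))
    (hm : WeaklyMajorised (subThermal μ') (subThermal μ)) :
    ∃ q : Fin n → ℝ, (∀ i, 0 ≤ q i) ∧ (∀ i, q i ≤ 1) ∧ (Antitone fun i => q i * μ i) ∧
      Majorised μ' fun i => q i * μ i := by
  have supT_nonneg (x : Fin n → ℝ) (i) : 0 ≤ superThermal x i := le_max_right _ _
  have subT_nonneg (x : Fin n → ℝ) (i) : 0 ≤ subThermal x i := le_max_right _ _
  have hmaj := (hp.truncation (supT_nonneg μ')).sub_rev (hm.truncation (subT_nonneg μ'))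
  rw [superThermal_sub_subThermal_rev] at hmaj
  set zp := truncation (superThermal μ) (∑ i, superThermal μ' i)
  set zm := truncation (subThermal μ) (∑ i, subThermal μ' i)
  have hzp (i) : 0 ≤ zp i := truncation_nonneg (supT_nonneg μ) _ i
  have hzm (i) : 0 ≤ zm i := truncation_nonneg (subT_nonneg μ) _ i
  have hzp' (i) : zp i ≤ max (μ i) 0 := truncation_le (supT_nonneg μ) _ i
  have hzm' (i : Fin n) : zm i.rev ≤ max (-μ i) 0 := by
    have : zm i.rev ≤ subThermal μ i.rev := truncation_le (subT_nonneg μ) _ i.rev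
    rwa [subThermal, Fin.rev_rev] at this
  have anti : Antitone fun i => zp i - zm i.rev := fun i j hij =>
    sub_le_sub (truncation_antitone (supT_nonneg μ) (superThermal_antitone hμ) _ hij)
      (truncation_antitone (subT_nonneg μ) (subThermal_antitone hμ) _ (Fin.rev_le_rev.2 hij))
  -- At most one of `zp i` and `zm i.rev` is nonzero, according to the sign of `μ i`, so their
  -- difference lies between `0` and `μ i`.
  have hq (i) : ∃ q : ℝ, 0 ≤ q ∧ q ≤ 1 ∧ zp i - zm i.rev = q * μ i := by
    have h1 := hzp i
    have h2 := hzp' i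
    have h3 := hzm i.rev
    have h4 := hzm' i
    rcases lt_trichotomy (μ i) 0 with h | h | h
    · rw [max_eq_right h.le] at h2
      rw [max_eq_left (by linarith)] at h4
      refine ⟨(zp i - zm i.rev) / μ i, div_nonneg_of_nonpos (by linarith) h.le,
        (div_le_one_of_neg h).2 (by linarith), (div_mul_cancel₀ _ h.ne).symm⟩
    · rw [h] at h2 h4
      simp at h2 h4
      exact ⟨0, le_rfl, zero_le_one, by linarith⟩
    · rw [max_eq_left h.le] at h2
      rw [max_eq_right (by linarith)] at h4
      refine ⟨(zp i - zm i.rev) / μ i, div_nonneg (by linarith) h.le,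
        (div_le_one h).2 (by linarith), (div_mul_cancel₀ _ h.ne').symm⟩
  choose q hq0 hq1 hq using hq
  refine ⟨q, hq0, hq1, ?_, ?_⟩ <;> simpa only [← hq]

end Majorisation

/-! ### Construction of the catalyst -/

/-- Exchanging the second and third summand of a direct sum. -/
theorem UEquiv.swap {ι κ l : Type*} [Fintype ι] [Fintype κ] [Fintype l] [DecidableEq ι]
    [DecidableEq κ] [DecidableEq l] (A : Matrix ι ι ℂ) (B : Matrix ι κ ℂ) (C : Matrix κ ι ℂ)
    (D : Matrix κ κ ℂ) (E : Matrix l l ℂ) :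
    UEquiv (fromBlocks (fromBlocks A B C D) 0 0 E)
      (fromBlocks (fromBlocks A 0 0 E) (fromRows B 0) (fromCols C 0) D) := by
  let e : (ι ⊕ l) ⊕ κ ≃ (ι ⊕ κ) ⊕ l :=
    ((Equiv.sumAssoc ι l κ).trans (Equiv.sumCongr (Equiv.refl ι) (Equiv.sumComm l κ))).trans
      (Equiv.sumAssoc ι κ l).symm
  convert UEquiv.submatrix (fromBlocks (fromBlocks A B C D) 0 0 E) e using 1
  ext ((i | i) | i) ((j | j) | j) <;> rfl

/-- The last entry is repeated forever, which keeps the sequence antitone on all of `ℕ`, as the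
averaging induction requires. -/
theorem exists_antitone_extension {n : ℕ} {x : Fin (n + 1) → ℝ} (hx : Antitone x) :
    ∃ y : ℕ → ℝ, Antitone y ∧ (∀ i : Fin (n + 1), y i = x i) ∧
      ∀ k ≤ n + 1, ∑ i ∈ Finset.range k, y i = partialSum x k := by
  let y : ℕ → ℝ := fun i => x ⟨min i n, by omega⟩
  have hy (i : Fin (n + 1)) : y i = x i := by
    simp only [y]
    congr 1
    ext
    exact min_eq_left (by omega)
  refine ⟨y, fun i j h => hx (min_le_min_right n h), hy, fun k hk => ?_⟩
  induction k with
  | zero => simp [partialSum_zero]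
  | succ k ih =>
    rw [Finset.sum_range_succ, ih (by omega), partialSum_succ _ hk, ← hy]

/-- With `n - 1` catalyst modes, a spectrum can be exchanged for any majorised one. -/
theorem exists_catalyst_spectrum {n : ℕ} {u v : Fin n → ℝ} (hu : Antitone u) (hv : Antitone v)
    (h : Majorised u v) :
    ∃ γ : Fin (n - 1) → ℝ, (∀ L, (∀ i, L ≤ v i) → ∀ k, L ≤ γ k) ∧ ∃ Y Y',
      UEquiv (fromBlocks (realDiagonal v) 0 0 (realDiagonal γ))
        (fromBlocks (realDiagonal u) Y Y' (realDiagonal γ)) := by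
  obtain _ | m := n
  · refine ⟨0, fun _ _ k => k.elim0, 0, 0, ?_⟩
    rw [Subsingleton.elim v u]
    exact UEquiv.refl _
  obtain ⟨u', hu', huu, hus⟩ := exists_antitone_extension hu
  obtain ⟨v', hv', hvv, hvs⟩ := exists_antitone_extension hv
  obtain ⟨h1, h2⟩ := h
  rw [weaklyMajorised_iff] at h1
  obtain ⟨a, b, γ, p, hp, hp', hf, hγ, hms, hL⟩ := exists_pairwise_averaging m u' v' hu' hv'
    (fun k hk => by rw [hus k hk, hvs k hk]; exact h1 k hk)
    (by rw [hus _ le_rfl, hvs _ le_rfl, partialSum_last, partialSum_last, h2])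
  refine ⟨γ, fun L hLv => hL L fun i hi => ?_, ?_⟩
  · have := hLv ⟨i, by omega⟩
    rwa [← hvv] at this
  let f : Fin m → ℝ := fun k => u' k
  let w : Fin 1 → ℝ := fun _ => u' m
  -- System and catalyst eigenvalues together are regrouped into the pairs to be mixed, plus one
  -- entry that already has its final value `u' m`.
  have e1 : UEquiv (fromBlocks (realDiagonal v) 0 0 (realDiagonal γ))
      (fromBlocks (fromBlocks (realDiagonal a) 0 0 (realDiagonal b)) 0 0 (realDiagonal w)) := by
    rw [fromBlocks_realDiagonal, fromBlocks_realDiagonal, fromBlocks_realDiagonal]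
    refine UEquiv.realDiagonal_of_multiset_eq ?_
    simp only [Fintype.sum_sum_type, Sum.elim_inl, Sum.elim_inr, Finset.univ_unique,
      Finset.sum_singleton, w]
    rw [hms, Finset.sum_range]
    simp [hvv]
  obtain ⟨Y, Y', e2⟩ := UEquiv.rotation (a := a) (b := b) hp hp'
  rw [show (fun k => p k * a k + (1 - p k) * b k) = f from funext fun k => (hf k).symm,
    show (fun k => (1 - p k) * a k + p k * b k) = γ from funext fun k => (hγ k).symm] at e2
  have e3 := (e1.trans (e2.directSum (UEquiv.refl _))).trans (UEquiv.swap _ _ _ _ _)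
  have e4 : UEquiv (fromBlocks (realDiagonal f) 0 0 (realDiagonal w)) (realDiagonal u) := by
    rw [fromBlocks_realDiagonal]
    refine UEquiv.realDiagonal_of_multiset_eq ?_
    simp only [Fintype.sum_sum_type, Sum.elim_inl, Sum.elim_inr, Finset.univ_unique,
      Finset.sum_singleton, w, f, Fin.sum_univ_castSucc, ← huu, Fin.val_castSucc, Fin.val_last]
  obtain ⟨B, C, e5⟩ := e4.diagBlocks (UEquiv.refl (realDiagonal γ)) _ _
  exact ⟨B, C, e3.trans e5⟩

/-! ### Sufficiency and necessity of the majorisation conditions -/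

section Transformations

variable {β ω : ℝ} {n c b : ℕ} {σ : Matrix (Fin n ⊕ Fin n) (Fin n ⊕ Fin n) ℝ}
  {M' : Matrix (Fin n) (Fin n) ℂ}

/-- If the bath can bring the spectrum of the system to one that majorises the target, then
`n - 1` catalyst modes do the rest. -/
theorem weakCatalytic_of_majorised (hσ : σ.IsSymm) (hM' : M'.IsHermitian) {z : Fin n → ℝ}
    (hz : Antitone z) (hzσ : ∀ i, -(thermalVariance β ω - 1 / 2) ≤ z i)
    (hmaj : Majorised (eigenvalueVector hM') z)
    (hbath : ∀ γ : Fin (n - 1) → ℝ, ∃ B C E,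
      UEquiv (fromBlocks (fromBlocks (modeMatrix β ω σ) 0 0 (realDiagonal γ)) 0 0
          (0 : Matrix (Fin b) (Fin b) ℂ))
        (fromBlocks (fromBlocks (realDiagonal z) 0 0 (realDiagonal γ)) B C
          (E : Matrix (Fin b) (Fin b) ℂ))) :
    WeakCatalytic β ω (n - 1) b σ M' := by
  obtain ⟨γ, hγ, Y, Y', e1⟩ :=
    exists_catalyst_spectrum (eigenvalueVector_antitone hM') hz hmaj
  obtain ⟨B, C, E, e2⟩ := hbath γ
  obtain ⟨Y₁, Y₁', e3⟩ := (UEquiv.realDiagonal_eigenvalueVector hM').symm.diagBlocks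
    (UEquiv.refl (realDiagonal γ)) Y Y'
  obtain ⟨B₁, C₁, e4⟩ := (e1.trans e3).diagBlocks (UEquiv.refl E) B C
  exact weakCatalytic_of_uequiv hσ (hγ _ hzσ) (e2.trans e4)

theorem neg_le_eigenvalueVector (hσ : IsCovarianceMatrix σ)
    (hM : (modeMatrix β ω σ).IsHermitian) (i : Fin n) :
    -(thermalVariance β ω - 1 / 2) ≤ eigenvalueVector hM i :=
  (UEquiv.realDiagonal_eigenvalueVector hM).neg_le_of_posSemidef
    (modeMatrix_add_posSemidef β ω hσ) i

theorem weakCatalytic_without_bath (hσ : IsCovarianceMatrix σ)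
    (hM : (modeMatrix β ω σ).IsHermitian) (hM' : M'.IsHermitian)
    (h : Majorised (eigenvalueVector hM') (eigenvalueVector hM)) :
    WeakCatalytic β ω (n - 1) 0 σ M' :=
  weakCatalytic_of_majorised hσ.1 hM' (eigenvalueVector_antitone hM)
    (neg_le_eigenvalueVector hσ hM) h fun _ =>
      ⟨0, 0, 0, ((UEquiv.realDiagonal_eigenvalueVector hM).directSum (UEquiv.refl _)).directSum
        (UEquiv.refl _)⟩

theorem half_le_thermalVariance (hβ : 0 < β) (hω : 0 < ω) : 1 / 2 ≤ thermalVariance β ω := by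
  have : 1 < Real.exp (β * ω) := Real.one_lt_exp_iff.2 (mul_pos hβ hω)
  rw [thermalVariance, div_le_div_iff₀ (by norm_num) (by linarith)]
  linarith

theorem weakCatalytic_with_bath (hβ : 0 < β) (hω : 0 < ω) (hσ : IsCovarianceMatrix σ)
    (hM : (modeMatrix β ω σ).IsHermitian) (hM' : M'.IsHermitian)
    (hp : WeaklyMajorised (superThermal (eigenvalueVector hM'))
      (superThermal (eigenvalueVector hM)))
    (hm : WeaklyMajorised (subThermal (eigenvalueVector hM'))
      (subThermal (eigenvalueVector hM))) :
    WeakCatalytic β ω (n - 1) n σ M' := by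
  obtain ⟨q, hq, hq', hanti, hmaj⟩ :=
    exists_attenuation (eigenvalueVector_antitone hM) hp hm
  refine weakCatalytic_of_majorised hσ.1 hM' hanti (fun i => ?_) hmaj fun γ => ?_
  · have h1 := half_le_thermalVariance hβ hω
    have h2 := neg_le_eigenvalueVector hσ hM i
    nlinarith [mul_nonneg (hq i) (sub_nonneg.2 h2), hq' i]
  · obtain ⟨Y, Y', e⟩ := UEquiv.rotation (a := eigenvalueVector hM) (b := 0) hq hq'
    have hzero : realDiagonal (0 : Fin n → ℝ) = 0 := by ext; simp [realDiagonal]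
    simp only [Pi.zero_apply, mul_zero, add_zero, hzero] at e
    have e1 := ((UEquiv.realDiagonal_eigenvalueVector hM).directSum
      (UEquiv.refl (realDiagonal γ))).directSum (UEquiv.refl (0 : Matrix (Fin n) (Fin n) ℂ))
    have e2 := UEquiv.swap (realDiagonal (eigenvalueVector hM)) 0 0 (realDiagonal γ)
      (0 : Matrix (Fin n) (Fin n) ℂ)
    simp only [fromRows_zero, fromCols_zero] at e2
    exact ⟨_, _, _, ((e1.trans e2).trans (e.directSum (UEquiv.refl _))).trans
      (UEquiv.swap _ _ _ _ _)⟩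

/-- The catalyst block has the same spectrum on both sides and cancels. The numbers `δ` are the
diagonal entries of the outgoing bath block. -/
theorem WeakCatalytic.sum_convex_le (h : WeakCatalytic β ω c b σ M') (hσ : σ.IsSymm)
    (hM : (modeMatrix β ω σ).IsHermitian) (hM' : M'.IsHermitian) {φ : ℝ → ℝ}
    (hφ : ConvexOn ℝ Set.univ φ) :
    ∃ δ : Fin b → ℝ, ∑ i, φ (eigenvalueVector hM' i) + ∑ i, φ (δ i) ≤
      ∑ i, φ (eigenvalueVector hM i) + b * φ 0 := by
  obtain ⟨MC, hMC, Y, Y', B, C, E, e⟩ := h.exists_uequiv hσ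
  have eC := UEquiv.realDiagonal_eigenvalueVector hMC
  obtain ⟨Y₁, Y₁', e1⟩ := (UEquiv.realDiagonal_eigenvalueVector hM').diagBlocks eC Y Y'
  obtain ⟨B₁, C₁, e2⟩ := e1.diagBlocks (UEquiv.refl E) B C
  have e3 := ((UEquiv.realDiagonal_eigenvalueVector hM).directSum eC).directSum
    (UEquiv.refl (0 : Matrix (Fin b) (Fin b) ℂ))
  have hzero : (0 : Matrix (Fin b) (Fin b) ℂ) = realDiagonal 0 := by ext; simp [realDiagonal]
  have e4 := e3.symm.trans (e.trans e2)
  rw [hzero, fromBlocks_realDiagonal, fromBlocks_realDiagonal] at e4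
  have := e4.sum_convex_le hφ
  refine ⟨fun i => (E i i).re, ?_⟩
  simp only [Fintype.sum_sum_type, fromBlocks_apply₁₁, fromBlocks_apply₂₂, Sum.elim_inl,
    Sum.elim_inr, realDiagonal, diagonal_apply_eq, Complex.ofReal_re, Pi.zero_apply,
    Finset.sum_const, Finset.card_univ, Fintype.card_fin, nsmul_eq_mul] at this
  linarith

theorem convexOn_max_sub (t : ℝ) : ConvexOn ℝ Set.univ fun x : ℝ => max (x - t) 0 := by
  simp only [sub_eq_add_neg]
  exact ((convexOn_id convex_univ).add (convexOn_const (-t) convex_univ)).sup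
    (convexOn_const 0 convex_univ)

theorem WeakCatalytic.majorised (h : WeakCatalytic β ω c 0 σ M') (hσ : σ.IsSymm)
    (hM : (modeMatrix β ω σ).IsHermitian) (hM' : M'.IsHermitian) :
    Majorised (eigenvalueVector hM') (eigenvalueVector hM) := by
  have key {φ : ℝ → ℝ} (hφ : ConvexOn ℝ Set.univ φ) :
      ∑ i, φ (eigenvalueVector hM' i) ≤ ∑ i, φ (eigenvalueVector hM i) := by
    obtain ⟨δ, hδ⟩ := h.sum_convex_le hσ hM hM' hφ
    simpa using hδ
  refine ⟨weaklyMajorised_of_sum_max_le (eigenvalueVector_antitone hM) fun k =>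
    key (convexOn_max_sub _), le_antisymm (key (convexOn_id convex_univ)) ?_⟩
  have := key (concaveOn_id (𝕜 := ℝ) convex_univ).neg
  simpa using this

theorem WeakCatalytic.weaklyMajorised (h : WeakCatalytic β ω c b σ M') (hσ : σ.IsSymm)
    (hM : (modeMatrix β ω σ).IsHermitian) (hM' : M'.IsHermitian) :
    WeaklyMajorised (superThermal (eigenvalueVector hM')) (superThermal (eigenvalueVector hM)) ∧
      WeaklyMajorised (subThermal (eigenvalueVector hM')) (subThermal (eigenvalueVector hM)) := by
  have key {φ : ℝ → ℝ} (hφ : ConvexOn ℝ Set.univ φ) (h0 : φ 0 = 0) (hpos : ∀ x, 0 ≤ φ x) :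
      ∑ i, φ (eigenvalueVector hM' i) ≤ ∑ i, φ (eigenvalueVector hM i) := by
    obtain ⟨δ, hδ⟩ := h.sum_convex_le hσ hM hM' hφ
    have : 0 ≤ ∑ i, φ (δ i) := Finset.sum_nonneg fun i _ => hpos _
    rw [h0, mul_zero, add_zero] at hδ
    linarith
  -- For thresholds `t ≥ 0`, first cutting off at `0` changes nothing, so the test function may be
  -- applied to the eigenvalues directly.
  have max_max (x t : ℝ) (ht : 0 ≤ t) : max (max x 0 - t) 0 = max (x - t) 0 := by
    rcases le_total x 0 with hx | hx
    · rw [max_eq_right hx, max_eq_right (by linarith), max_eq_right (by linarith)]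
    · rw [max_eq_left hx]
  have anti := eigenvalueVector_antitone hM
  constructor
  · refine weaklyMajorised_of_sum_max_le (superThermal_antitone anti) fun k => ?_
    have ht : 0 ≤ superThermal (eigenvalueVector hM) k := le_max_right _ _
    generalize superThermal (eigenvalueVector hM) k = t at ht
    simp only [superThermal, max_max _ t ht]
    exact key (convexOn_max_sub t) (max_eq_right (by linarith)) fun _ => le_max_right _ _
  · refine weaklyMajorised_of_sum_max_le (subThermal_antitone anti) fun k => ?_
    have ht : 0 ≤ subThermal (eigenvalueVector hM) k := le_max_right _ _
    generalize subThermal (eigenvalueVector hM) k = t at ht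
    simp only [subThermal, max_max _ t ht]
    rw [← Equiv.sum_comp Fin.revPerm, ← Equiv.sum_comp Fin.revPerm (fun i : Fin n =>
      max (-eigenvalueVector hM i.rev - t) 0)]
    simp only [Fin.revPerm_apply, Fin.rev_rev]
    refine key (φ := fun x => max (-x - t) 0) ?_ (max_eq_right (by linarith))
      fun _ => le_max_right _ _
    simp only [sub_eq_add_neg]
    exact ((concaveOn_id convex_univ).neg.add (convexOn_const (-t) convex_univ)).sup
      (convexOn_const 0 convex_univ)

end Transformations

end GaussianThermal

open GaussianThermal in
theorem theorem6 (β ω : ℝ) (hβ : 0 < β) (hω : 0 < ω) (n : ℕ)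
    (σ : Matrix (Fin n ⊕ Fin n) (Fin n ⊕ Fin n) ℝ) (hσ : IsCovarianceMatrix σ)
    (M M' : Matrix (Fin n) (Fin n) ℂ) (hσM : modeMatrix β ω σ = M)
    (hM : M.IsHermitian) (hM' : M'.IsHermitian) :
    (((∃ c : ℕ, WeakCatalytic β ω c 0 σ M') ↔
        Majorised (eigenvalueVector hM') (eigenvalueVector hM)) ∧
      ((∃ c : ℕ, WeakCatalytic β ω c 0 σ M') →
        ∃ c : ℕ, c ≤ n - 1 ∧ WeakCatalytic β ω c 0 σ M')) ∧
    (((∃ c b : ℕ, WeakCatalytic β ω c b σ M') ↔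
        WeaklyMajorised (superThermal (eigenvalueVector hM'))
            (superThermal (eigenvalueVector hM)) ∧
          WeaklyMajorised (subThermal (eigenvalueVector hM'))
            (subThermal (eigenvalueVector hM))) ∧
      ((∃ c b : ℕ, WeakCatalytic β ω c b σ M') →
        ∃ c b : ℕ, c ≤ n - 1 ∧ b ≤ n ∧ WeakCatalytic β ω c b σ M')) := by
  subst hσM
  have fwd (h : ∃ c : ℕ, WeakCatalytic β ω c 0 σ M') :
      Majorised (eigenvalueVector hM') (eigenvalueVector hM) :=
    h.elim fun _ hc => hc.majorised hσ.1 hM hM'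
  have fwd' (h : ∃ c b : ℕ, WeakCatalytic β ω c b σ M') :
      WeaklyMajorised (superThermal (eigenvalueVector hM'))
          (superThermal (eigenvalueVector hM)) ∧
        WeaklyMajorised (subThermal (eigenvalueVector hM'))
          (subThermal (eigenvalueVector hM)) :=
    h.elim fun _ hc => hc.elim fun _ hb => hb.weaklyMajorised hσ.1 hM hM'
  refine ⟨⟨⟨fwd, fun h => ⟨_, weakCatalytic_without_bath hσ hM hM' h⟩⟩, fun h =>
    ⟨n - 1, le_rfl, weakCatalytic_without_bath hσ hM hM' (fwd h)⟩⟩, ⟨fwd', fun h =>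
    ⟨_, _, weakCatalytic_with_bath hβ hω hσ hM hM' h.1 h.2⟩⟩, fun h => ⟨n - 1, n, le_rfl, le_rfl,
    weakCatalytic_with_bath hβ hω hσ hM hM' (fwd' h).1 (fwd' h).2⟩⟩
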